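/- Let $R$ be a commutative Noetherian ring and let $\operatorname{mod} R$ be the category of finitely generated $R$-modules. For a finitely generated $R$-module $M$ and an integer $n\ge 0$, let $$\mathrm{ca}_R^n(M)=\{r\in R \mid r\cdot \operatorname{Ext}_R^i(M,N)=0 \text{ for all } i\ge n \text{ and all } N\in \operatorname{mod} R\},$$ an ascending chain of ideals in $n$, and let $\mathrm{ca}_R(M)=\bigcup_{n\ge 0}\mathrm{ca}_R^n(M)$. Let $\mathsf D(R)$ be the derived category of $R$-modules, let $\mathsf D^f(R)$ be its full subcategory of complexes $X$ whose total cohomology $\bigoplus_{i\in\mathbb Z}H^i(X)$ is a finitely generated $R$-module, and let $\operatorname{thick}(R)$ be the smallest thick subcategory of $\mathsf D(R)$ containing $R$ (the perfect complexes). The singularity category of $R$ is the Verdier quotient $\mathsf D_{\mathsf{sg}}(R)=\mathsf D^f(R)/\operatorname{thick}(R)$, with its natural $R$-linear structure. For an object $X$ of $\mathsf D_{\mathsf{sg}}(R)$ put $$\operatorname{ann}_{\mathsf D_{\mathsf{sg}}(R)}(X)=\{r\in R\mid r\cdot \operatorname{Hom}_{\mathsf D_{\mathsf{sg}}(R)}(X,X)=0\},$$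 and let $\operatorname{ann}_R\mathsf D_{\mathsf{sg}}(R)=\bigcap_{X\in\mathsf D_{\mathsf{sg}}(R)}\operatorname{ann}_{\mathsf D_{\mathsf{sg}}(R)}(X)$. Then, regarding a module as a complex concentrated in degree $0$, for every finitely generated $R$-module $M$, $$\mathrm{ca}_R(M)=\operatorname{ann}_{\mathsf D_{\mathsf{sg}}(R)}(M),$$ and moreover $$\operatorname{ann}_R\mathsf D_{\mathsf{sg}}(R)=\bigcap_{M\in\operatorname{mod} R}\mathrm{ca}_R(M).$$ -/

import Mathlib

open CategoryTheory CategoryTheory.Abelian CategoryTheory.Limits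

universe w u

noncomputable section

namespace CohAnn

variable (R : Type u) [CommRing R]

/-! ### Cohomological annihilators of modules -/

/-- The `n`-th cohomological annihilator of `M`: the ideal of all `r : R` with
`r • Ext^i(M, N) = 0` for every `i ≥ n` and every finitely generated `R`-module `N`. -/
def caLevel (n : ℕ) (M : ModuleCat.{u} R) : Ideal R :=
  ⨅ (i : ℕ) (_ : n ≤ i) (N : FGModuleCat.{u} R), Module.annihilator R (Ext M N.obj i)

/-- The cohomological annihilator of `M`: the union of the ascending chain of the ideals
`caLevel R n M` (see `coe_ca` for the fact that the supremum is the union). -/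
def ca (M : ModuleCat.{u} R) : Ideal R := ⨆ n : ℕ, caLevel R n M

variable {R}

lemma mem_caLevel_iff {n : ℕ} {M : ModuleCat.{u} R} {r : R} :
    r ∈ caLevel R n M ↔
      ∀ i : ℕ, n ≤ i → ∀ (N : FGModuleCat.{u} R) (e : Ext M N.obj i), r • e = 0 := by
  simp only [caLevel, Submodule.mem_iInf, Module.mem_annihilator]

lemma caLevel_mono (M : ModuleCat.{u} R) : Monotone (fun n : ℕ => caLevel R n M) := by
  intro m n h r hr
  rw [mem_caLevel_iff] at hr ⊢
  exact fun i hi => hr i (h.trans hi)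

lemma coe_ca (M : ModuleCat.{u} R) : (ca R M : Set R) = ⋃ n : ℕ, (caLevel R n M : Set R) :=
  Submodule.coe_iSup_of_directed _ (caLevel_mono M).directed_le

lemma mem_ca_iff {M : ModuleCat.{u} R} {r : R} :
    r ∈ ca R M ↔ ∃ n : ℕ, r ∈ caLevel R n M :=
  Submodule.mem_iSup_of_directed _ (caLevel_mono M).directed_le

/-! ### The singularity category -/

/-- A direct sum of modules is finitely generated if and only if all summands are and all but
finitely many of them are zero. -/
lemma finite_directSum_iff {H : ℤ → Type u} [∀ i, AddCommGroup (H i)] [∀ i, Module R (H i)] :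
    Module.Finite R (DirectSum ℤ H) ↔
      (∀ i, Module.Finite R (H i)) ∧ {i | Nontrivial (H i)}.Finite := by
  classical
  constructor
  · intro h
    refine ⟨fun i => Module.Finite.of_surjective (DirectSum.component R ℤ H i)
      (fun x => ⟨DirectSum.lof R ℤ H i x, DirectSum.component.lof_self (R := R) (M := H) i x⟩), ?_⟩
    obtain ⟨s, hs⟩ := h.fg_top
    refine Set.Finite.subset (s.biUnion fun x => DFinsupp.support x).finite_toSet ?_
    intro i hi
    by_contra hn
    have hz : ∀ x : DirectSum ℤ H, DirectSum.component R ℤ H i x = 0 := by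
      have hle : (⊤ : Submodule R (DirectSum ℤ H)) ≤
          LinearMap.ker (DirectSum.component R ℤ H i) := by
        rw [← hs, Submodule.span_le]
        intro x hx
        by_contra hx0
        refine hn ?_
        simp only [Finset.coe_biUnion, Set.mem_iUnion]
        exact ⟨x, hx, DFinsupp.mem_support_iff.2 hx0⟩
      exact fun x => hle trivial
    obtain ⟨y, hy⟩ := @exists_ne _ hi (0 : H i)
    refine hy ?_
    rw [← DirectSum.component.lof_self (R := R) (M := H) i y]
    exact hz _
  · rintro ⟨hf, hs⟩
    have key : (⊤ : Submodule R (DirectSum ℤ H)) =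
        ⨆ i ∈ hs.toFinset, LinearMap.range (DirectSum.lof R ℤ H i) := by
      symm
      rw [eq_top_iff]
      rintro x -
      induction x using DirectSum.induction_on with
      | zero => exact zero_mem _
      | of i y =>
        by_cases hi : Nontrivial (H i)
        · have : i ∈ hs.toFinset := by simpa using hi
          exact Submodule.mem_iSup_of_mem i (Submodule.mem_iSup_of_mem this ⟨y, rfl⟩)
        · rw [not_nontrivial_iff_subsingleton] at hi
          rw [Subsingleton.elim y 0, map_zero]
          exact zero_mem _
      | add x y hx hy => exact add_mem hx hy
    refine ⟨?_⟩
    rw [key]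
    refine Submodule.fg_biSup _ _ fun i _ => ?_
    have := hf i
    rw [LinearMap.range_eq_map]
    exact Submodule.FG.map _ Module.Finite.fg_top

variable (R)
variable [HasDerivedCategory.{w} (ModuleCat.{u} R)]

/-- The objects of `D^f(R)`: the complexes in `D(R)` whose total cohomology
`⨁ i, H^i(X)` is a finitely generated `R`-module. -/
def boundedDerived : ObjectProperty (DerivedCategory (ModuleCat.{u} R)) := fun X =>
  Module.Finite R
    (DirectSum ℤ fun i => ((DerivedCategory.homologyFunctor (ModuleCat.{u} R) i).obj X : Type u))

variable {R} in
lemma boundedDerived_iff (X : DerivedCategory (ModuleCat.{u} R)) :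
    boundedDerived R X ↔
      (∀ i : ℤ, Module.Finite R ((DerivedCategory.homologyFunctor (ModuleCat.{u} R) i).obj X)) ∧
      {i : ℤ | Nontrivial
        ((DerivedCategory.homologyFunctor (ModuleCat.{u} R) i).obj X : Type u)}.Finite :=
  finite_directSum_iff

instance : (boundedDerived R).IsClosedUnderIsomorphisms where
  of_iso {X Y} e hX := by
    rw [boundedDerived_iff] at hX ⊢
    have f : ∀ i : ℤ, (DerivedCategory.homologyFunctor (ModuleCat.{u} R) i).obj X ≃ₗ[R]
        (DerivedCategory.homologyFunctor (ModuleCat.{u} R) i).obj Y := fun i =>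
      ((DerivedCategory.homologyFunctor (ModuleCat.{u} R) i).mapIso e).toLinearEquiv
    refine ⟨fun i => ?_, hX.2.subset fun i hi => ?_⟩
    · have := hX.1 i
      exact Module.Finite.equiv (f i)
    · have : Nontrivial _ := hi
      exact (f i).toEquiv.nontrivial

instance : (boundedDerived R).IsStableUnderShift ℤ where
  isStableUnderShiftBy a := ⟨fun X hX => by
    rw [ObjectProperty.prop_shift_iff, boundedDerived_iff]
    rw [boundedDerived_iff] at hX
    have f : ∀ i : ℤ, (DerivedCategory.homologyFunctor (ModuleCat.{u} R) i).obj
        ((shiftFunctor (DerivedCategory (ModuleCat.{u} R)) a).obj X) ≃ₗ[R]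
        (DerivedCategory.homologyFunctor (ModuleCat.{u} R) (a + i)).obj X := fun i =>
      (((DerivedCategory.homologyFunctor (ModuleCat.{u} R) 0).shiftIso a i (a + i) rfl).app
        X).toLinearEquiv
    refine ⟨fun i => ?_, ?_⟩
    · have := hX.1 (a + i)
      exact Module.Finite.equiv (f i).symm
    · refine (hX.2.preimage (add_right_injective a).injOn).subset fun i hi => ?_
      have : Nontrivial _ := hi
      exact (f i).symm.toEquiv.nontrivial⟩

lemma boundedDerived_single (M : ModuleCat.{u} R) [Module.Finite R M] :
    boundedDerived R ((DerivedCategory.singleFunctor (ModuleCat.{u} R) 0).obj M) := by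
  rw [boundedDerived_iff]
  have hz : ∀ i : ℤ, i ≠ 0 → Subsingleton ((DerivedCategory.homologyFunctor (ModuleCat.{u} R) i).obj
      ((DerivedCategory.singleFunctor (ModuleCat.{u} R) 0).obj M) : Type u) := by
    intro i hi
    rw [← ModuleCat.isZero_iff_subsingleton]
    rcases lt_or_gt_of_ne hi with h | h
    · exact DerivedCategory.isZero_of_isGE _ 0 i h
    · exact DerivedCategory.isZero_of_isLE _ 0 i h
  refine ⟨fun i => ?_, (Set.finite_singleton (0 : ℤ)).subset fun i hi => ?_⟩
  · by_cases hi : i = 0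
    · subst hi
      have : Module.Finite R ((𝟭 (ModuleCat.{u} R)).obj M) := inferInstanceAs (Module.Finite R M)
      exact Module.Finite.equiv
        ((DerivedCategory.singleFunctorCompHomologyFunctorIso
          (ModuleCat.{u} R) 0).app M).toLinearEquiv.symm
    · have := hz i hi
      infer_instance
  · by_contra h
    have h1 : Nontrivial _ := hi
    exact not_nontrivial_iff_subsingleton.2 (hz i h) h1

instance : (boundedDerived R).ContainsZero where
  exists_zero := by
    refine ⟨(DerivedCategory.singleFunctor (ModuleCat.{u} R) 0).obj (ModuleCat.of R PUnit),
      Functor.map_isZero _ ?_, boundedDerived_single R _⟩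
    rw [ModuleCat.isZero_iff_subsingleton]
    infer_instance

instance [IsNoetherianRing R] : (boundedDerived R).IsTriangulatedClosed₂ :=
  .mk' fun T hT h₁ h₃ => by
    rw [boundedDerived_iff] at h₁ h₃ ⊢
    have hex : ∀ i : ℤ, Function.Exact
        ((DerivedCategory.homologyFunctor (ModuleCat.{u} R) i).map T.mor₁).hom
        ((DerivedCategory.homologyFunctor (ModuleCat.{u} R) i).map T.mor₂).hom := fun i =>
      (ShortComplex.ShortExact.moduleCat_exact_iff_function_exact _).1
        (DerivedCategory.HomologySequence.exact₂ T hT i)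
    refine ⟨fun i => ?_, (h₁.2.union h₃.2).subset fun i hi => ?_⟩
    · have := h₁.1 i
      have := h₃.1 i
      have := isNoetherian_of_range_eq_ker _ _ (LinearMap.exact_iff.1 (hex i)).symm
      infer_instance
    · by_contra hn
      have h1 : Nontrivial _ := hi
      simp only [Set.mem_union, Set.mem_ofPred_eq, not_or, not_nontrivial_iff_subsingleton] at hn
      obtain ⟨hn₁, hn₃⟩ := hn
      obtain ⟨x, hx⟩ := @exists_ne _ h1 0
      obtain ⟨y, hy⟩ := (hex i x).1 (Subsingleton.elim _ _)
      rw [Subsingleton.elim y 0, map_zero] at hy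
      exact hx hy.symm

instance [IsNoetherianRing R] : (boundedDerived R).IsTriangulated where

/-- The perfect complexes: the smallest thick subcategory of `D(R)` containing `R`. -/
def perfect : ObjectProperty (DerivedCategory (ModuleCat.{u} R)) :=
  (ObjectProperty.singleton
    ((DerivedCategory.singleFunctor (ModuleCat.{u} R) 0).obj (ModuleCat.of R R))).triangEnvelope

instance : (perfect R).IsTriangulated := by
  unfold perfect; infer_instance

instance : (perfect R).IsStableUnderRetracts := by
  unfold perfect; infer_instance

variable [IsNoetherianRing R]

/-- The singularity category `D_sg(R) = D^f(R) / thick(R)`: the localization of the triangulated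
category `D^f(R)` at the morphisms whose cone is perfect. -/
abbrev SingularityCategory :=
  ((perfect R).inverseImage (boundedDerived R).ι).trW.Localization

/-- The functor `mod R ⥤ D_sg(R)`: a finitely generated module is viewed as a complex concentrated
in degree `0`. -/
def toSingularityCategory : FGModuleCat.{u} R ⥤ SingularityCategory R :=
  (boundedDerived R).lift
    ((ModuleCat.isFG.{u} R).ι ⋙ DerivedCategory.singleFunctor (ModuleCat.{u} R) 0)
    (fun M => boundedDerived_single R M.obj) ⋙
  ((perfect R).inverseImage (boundedDerived R).ι).trW.Q

variable {R} in
/-- The annihilator over `R` of the `R`-module `End(X)`, for `X` in `D_sg(R)`. -/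
def annObj (X : SingularityCategory R) : Ideal R := Module.annihilator R (X ⟶ X)

/-- The annihilator of `D_sg(R)`: the intersection of the annihilators of all its objects. -/
def annSingularityCategory : Ideal R := ⨅ X : SingularityCategory R, annObj X

end CohAnn

end

/-! Both inclusions come from moving between `D(R)` and `D_sg(R)` through maps with perfect cone. If
`r` kills `Ext^n(M, -)`, kill the top cohomology of `M` repeatedly by coning off maps from finite
free modules (`exists_trW_single`). This yields a map from `M` to `N[n]`, with `N` finitely
generated, that becomes invertible in `D_sg(R)`. It is a class in `Ext^n(M, N)`, so `r` kills it and
hence kills the identity of `M` in `D_sg(R)`. Conversely, if `r` is zero on `M` in `D_sg(R)`,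
calculus of fractions gives `s : M ⟶ Y` with `r • s = 0` and perfect fibre. A perfect complex has no
nonzero map to `N[i]` for `i` large, uniformly in `N` (`perfect_le_vanishesOnConnective`). Thus
classes in `Ext^i(M, N)` factor through `s` and are killed by `r`. For the last equality, every
object of `D_sg(R)` is a shift of a finitely generated module. -/

namespace DerivedCategory

open Pretriangulated

universe v u'

variable {C : Type u'} [Category.{v} C] [Abelian C] [HasDerivedCategory.{w} C]

/-! ### Objects with no maps to sufficiently connective objects -/

variable (C) in
/-- The objects `X` of the derived category such that every morphism from `X` to a sufficiently
connective object vanishes. -/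
def vanishesOnConnective : ObjectProperty (DerivedCategory C) := fun X =>
  ∃ n : ℤ, ∀ (Y : DerivedCategory C) [Y.IsLE n] (f : X ⟶ Y), f = 0

instance : (vanishesOnConnective C).IsStableUnderRetracts where
  of_retract := by
    rintro X Y r ⟨n, hn⟩
    refine ⟨n, fun Z _ f => ?_⟩
    rw [← Category.id_comp f, ← r.retract, Category.assoc, hn Z (r.r ≫ f), comp_zero]

instance : (vanishesOnConnective C).ContainsZero where
  exists_zero := by
    obtain ⟨Z, hZ⟩ := HasZeroObject.zero (C := DerivedCategory C)
    exact ⟨Z, hZ, 0, fun _ _ f => hZ.eq_of_src f 0⟩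

instance : (vanishesOnConnective C).IsStableUnderShift ℤ where
  isStableUnderShiftBy a := ⟨fun X ⟨n, hn⟩ => by
    -- Maps `X⟦a⟧ ⟶ Y` correspond to maps `X ⟶ Y⟦-a⟧`, and shifting by `-a` raises the degree bound
    -- by `a`.
    refine ⟨n - a, fun Y _ f => ?_⟩
    have : (Y⟦-a⟧).IsLE n := TStructure.t.isLE_shift Y (n - a) (-a) n (by lia)
    apply (shiftFunctor (DerivedCategory C) (-a)).map_injective
    rw [Functor.map_zero]
    refine (cancel_epi ((shiftEquiv (DerivedCategory C) a).unitIso.hom.app X)).1 ?_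
    exact (hn _ _).trans (hn _ _).symm⟩

instance : (vanishesOnConnective C).IsTriangulatedClosed₂ :=
  .mk' fun T hT h₁ h₃ => by
    obtain ⟨n, hn⟩ := h₁
    obtain ⟨m, hm⟩ := h₃
    refine ⟨min n m, fun Y _ f => ?_⟩
    have : Y.IsLE n := TStructure.t.isLE_of_le Y (min n m) n (min_le_left _ _)
    have : Y.IsLE m := TStructure.t.isLE_of_le Y (min n m) m (min_le_right _ _)
    obtain ⟨g, rfl⟩ := Triangle.yoneda_exact₂ T hT f (hn Y _)
    rw [hm Y g, comp_zero]

instance : (vanishesOnConnective C).IsTriangulated where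

lemma vanishesOnConnective_singleFunctor (P : C) [Projective P] (i : ℤ) :
    vanishesOnConnective C ((singleFunctor C i).obj P) := by
  refine ⟨i - 1, fun Y _ f => ?_⟩
  obtain ⟨L, _, ⟨e⟩⟩ := exists_iso_Q_obj_of_isLE Y (i - 1)
  rw [← cancel_mono e.hom, zero_comp]
  exact from_singleFunctor_obj_eq_zero_of_projective (i := i) _ (i - 1) (by lia)

/-! ### Covering a cohomology object by a projective -/

/-- An epimorphism from a projective object to the cohomology of `X` lifts to cocycles, and thus
gives a morphism from a single complex to `X` which is surjective on this cohomology. -/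
lemma exists_from_singleFunctor_epi_homologyMap (X : DerivedCategory C) (b : ℤ) {P : C}
    [Projective P] (p : P ⟶ (homologyFunctor C b).obj X) [Epi p] :
    ∃ φ : (singleFunctor C b).obj P ⟶ X, Epi ((homologyFunctor C b).map φ) := by
  let K := Q.objPreimage X
  let e : Q.obj K ≅ X := Q.objObjPreimageIso X
  let h : (homologyFunctor C b).obj X ≅ K.homology b :=
    (homologyFunctor C b).mapIso e.symm ≪≫ (homologyFunctorFactors C b).app K
  let z : P ⟶ K.cycles b := Projective.factorThru (p ≫ h.hom) (K.homologyπ b)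
  have hz : z ≫ K.homologyπ b = p ≫ h.hom := Projective.factorThru_comp _ _
  let ψ : (HomologicalComplex.single C (ComplexShape.up ℤ) b).obj P ⟶ K :=
    HomologicalComplex.mkHomFromSingle (z ≫ K.iCycles b) (fun _ _ => by simp)
  have hψ : HomologicalComplex.cyclesMap ψ b =
      (HomologicalComplex.singleObjCyclesSelfIso _ b P).hom ≫ z := by
    rw [← cancel_mono (K.iCycles b), HomologicalComplex.cyclesMap_i,
      HomologicalComplex.mkHomFromSingle_f, HomologicalComplex.singleObjCyclesSelfIso_hom]
    simp
  have hepi : Epi (HomologicalComplex.homologyMap ψ b) := by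
    have : Epi (HomologicalComplex.homologyπ _ b ≫ HomologicalComplex.homologyMap ψ b) := by
      rw [HomologicalComplex.homologyπ_naturality, hψ, Category.assoc, hz]
      infer_instance
    exact epi_of_epi (HomologicalComplex.homologyπ _ b) _
  let φ : Q.obj ((HomologicalComplex.single C (ComplexShape.up ℤ) b).obj P) ⟶ X :=
    Q.map ψ ≫ e.hom
  let h' : (homologyFunctor C b).obj (Q.obj ((HomologicalComplex.single C _ b).obj P)) ≅
    ((HomologicalComplex.single C (ComplexShape.up ℤ) b).obj P).homology b :=
    (homologyFunctorFactors C b).app _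
  have hφ : (homologyFunctor C b).map φ ≫ h.hom =
      h'.hom ≫ HomologicalComplex.homologyMap ψ b := by
    refine Eq.trans ?_ (homologyFunctorFactors_hom_naturality ψ b)
    rw [Functor.map_comp, Category.assoc]
    congr 1
    exact ((homologyFunctor C b).mapIso e).hom_inv_id_assoc _
  have : Epi ((homologyFunctor C b).map φ) := by
    rw [← Category.comp_id ((homologyFunctor C b).map φ), ← h.hom_inv_id, ← Category.assoc, hφ]
    infer_instance
  exact ⟨φ, this⟩

end DerivedCategory

/-! ### Perfect complexes -/

namespace CohAnn
variable (R : Type u) [CommRing R] [HasDerivedCategory.{w} (ModuleCat.{u} R)]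

open DerivedCategory

/-- The vanishing condition defines a thick subcategory, so only the generator `R` needs checking,
and it is projective. -/
lemma perfect_le_vanishesOnConnective :
    perfect R ≤ vanishesOnConnective (ModuleCat.{u} R) := by
  unfold perfect
  rw [ObjectProperty.triangEnvelope_le_iff, ObjectProperty.singleton_le_iff]
  exact vanishesOnConnective_singleFunctor _ _

lemma perfect_singleFunctor_free (n : ℕ) (i : ℤ) :
    perfect R ((singleFunctor (ModuleCat.{u} R) i).obj
      (⨁ fun _ : Fin n => ModuleCat.of R R)) := by
  have h : perfect R ((singleFunctor (ModuleCat.{u} R) 0).obj (ModuleCat.of R R)) :=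
    ObjectProperty.le_triangEnvelope _ _ (by simp)
  have h' : perfect R ((singleFunctor (ModuleCat.{u} R) i).obj (ModuleCat.of R R)) :=
    (perfect R).prop_of_iso (((singleFunctors _).shiftIso (-i) i 0 (by lia)).app _)
      ((perfect R).le_shift (-i) _ h)
  refine (perfect R).prop_of_iso
    ((singleFunctor _ i).mapBiproduct _ ≪≫ biproduct.isoProduct _).symm ?_
  exact ObjectProperty.prop_limit _ _ (fun _ => h')

end CohAnn
-- Trading an object of `D^f(R)` for a module in one degree
namespace DerivedCategory

open Pretriangulated

universe v u'

variable {C : Type u'} [Category.{v} C] [Abelian C] [HasDerivedCategory.{w} C]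

/-- The cone of a morphism between objects in degrees `≤ b` which is surjective on cohomology in
degree `b` lives in degrees `< b`. -/
lemma isLE_obj₃_of_epi (T : Triangle (DerivedCategory C)) (hT : T ∈ distTriang _) (b : ℤ)
    [T.obj₁.IsLE b] [T.obj₂.IsLE b] [Epi ((homologyFunctor C b).map T.mor₁)] :
    T.obj₃.IsLE (b - 1) := by
  rw [isLE_iff]
  intro i hi
  refine (HomologySequence.exact₃ T hT i (i + 1)).isZero_of_both_zeros ?_
    ((isZero_of_isLE T.obj₁ b (i + 1) (by lia)).eq_of_tgt _ _)
  -- In degree `b` the second object may have cohomology, but surjectivity of the first map makes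
  -- its map to the cone zero.
  obtain rfl | hi := eq_or_lt_of_le (show b ≤ i by lia)
  · exact (HomologySequence.epi_homologyMap_mor₁_iff T hT b).1 inferInstance
  · exact (isZero_of_isLE T.obj₂ b i hi).eq_of_src _ _

lemma isGE_obj₃ (T : Triangle (DerivedCategory C)) (hT : T ∈ distTriang _) (a : ℤ)
    [T.obj₁.IsGE (a + 1)] [T.obj₂.IsGE a] : T.obj₃.IsGE a := by
  rw [isGE_iff]
  intro i hi
  exact (HomologySequence.exact₃ T hT i (i + 1)).isZero_of_both_zeros
    ((isZero_of_isGE T.obj₂ a i hi).eq_of_src _ _)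
    ((isZero_of_isGE T.obj₁ (a + 1) (i + 1) (by lia)).eq_of_tgt _ _)

end DerivedCategory

namespace CohAnn

open DerivedCategory Pretriangulated

variable (R : Type u) [CommRing R]

lemma finite_biproduct_fin (n : ℕ) :
    Module.Finite R (⨁ fun _ : Fin n => ModuleCat.of R R : ModuleCat.{u} R) :=
  Module.Finite.equiv (M := Fin n → R)
    (ModuleCat.biproductIsoPi fun _ : Fin n => ModuleCat.of R R).symm.toLinearEquiv

instance projective_biproduct_fin (n : ℕ) :
    Projective (⨁ fun _ : Fin n => ModuleCat.of R R : ModuleCat.{u} R) :=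
  Projective.of_iso (ModuleCat.biproductIsoPi fun _ : Fin n => ModuleCat.of R R).symm
    (inferInstanceAs (Projective (ModuleCat.of R (Fin n → R))))

lemma exists_epi_from_free (M : ModuleCat.{u} R) [Module.Finite R M] :
    ∃ (n : ℕ) (p : (⨁ fun _ : Fin n => ModuleCat.of R R) ⟶ M), Epi p := by
  obtain ⟨n, f, hf⟩ := Module.Finite.exists_fin' R M
  have : Epi (ModuleCat.ofHom f) := (ModuleCat.epi_iff_surjective _).2 hf
  exact ⟨n, (ModuleCat.biproductIsoPi fun _ : Fin n => ModuleCat.of R R).hom ≫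
    ModuleCat.ofHom f, epi_comp _ _⟩

variable [HasDerivedCategory.{w} (ModuleCat.{u} R)]

lemma boundedDerived_singleFunctor (M : ModuleCat.{u} R) [Module.Finite R M] (i : ℤ) :
    boundedDerived R ((singleFunctor (ModuleCat.{u} R) i).obj M) :=
  (boundedDerived R).prop_of_iso (((singleFunctors _).shiftIso (-i) i 0 (by lia)).app M)
    ((boundedDerived R).le_shift (-i) _ (boundedDerived_single R M))

variable {R}

lemma exists_isGE_isLE (X : (boundedDerived R).FullSubcategory) :
    ∃ a b : ℤ, X.obj.IsGE a ∧ X.obj.IsLE b := by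
  obtain ⟨-, hs⟩ := (boundedDerived_iff _).1 X.property
  obtain ⟨a, ha⟩ := hs.bddBelow
  obtain ⟨b, hb⟩ := hs.bddAbove
  refine ⟨a, b, (isGE_iff _ _).2 fun i hi => ?_, (isLE_iff _ _).2 fun i hi => ?_⟩ <;>
    rw [ModuleCat.isZero_iff_subsingleton, ← not_nontrivial_iff_subsingleton] <;> intro h
  · exact absurd (ha h) (not_le.2 hi)
  · exact absurd (hb h) (not_le.2 hi)

variable [IsNoetherianRing R]

/-- Up to a perfect complex, the top cohomology of an object of `D^f(R)` can be killed. -/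
lemma exists_trW_isLE_sub_one (X : (boundedDerived R).FullSubcategory) (a b : ℤ)
    [X.obj.IsGE a] [X.obj.IsLE b] (hab : a < b) :
    ∃ (Y : (boundedDerived R).FullSubcategory) (f : X ⟶ Y),
      ((perfect R).inverseImage (boundedDerived R).ι).trW f ∧
        Y.obj.IsGE a ∧ Y.obj.IsLE (b - 1) := by
  have := ((boundedDerived_iff _).1 X.property).1 b
  obtain ⟨n, p, _⟩ := exists_epi_from_free R ((homologyFunctor (ModuleCat.{u} R) b).obj X.obj)
  obtain ⟨φ, _⟩ := exists_from_singleFunctor_epi_homologyMap X.obj b p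
  obtain ⟨Y, g, h, hT⟩ := distinguished_cocone_triangle φ
  have := finite_biproduct_fin R n
  have hY : boundedDerived R Y := (boundedDerived R).ext_of_isTriangulatedClosed₃ _ hT
    (boundedDerived_singleFunctor R _ b) X.property
  refine ⟨⟨Y, hY⟩, ObjectProperty.homMk g, ?_, ?_, ?_⟩
  · rw [ObjectProperty.inverseImage_trW_iff]
    exact ObjectProperty.trW.mk' _ hT (perfect_singleFunctor_free R n b)
  -- Here `a < b` is needed: in the cone the free module moves to degree `b - 1`, which must not
  -- drop below `a`.
  · have : (Triangle.mk φ g h).obj₁.IsGE (a + 1) :=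
      TStructure.t.isGE_of_ge ((singleFunctor _ b).obj _) (a + 1) b (by lia)
    have : (Triangle.mk φ g h).obj₂.IsGE a := inferInstanceAs (X.obj.IsGE a)
    exact isGE_obj₃ _ hT a
  · have : (Triangle.mk φ g h).obj₁.IsLE b :=
      inferInstanceAs (((singleFunctor _ b).obj _).IsLE b)
    have : (Triangle.mk φ g h).obj₂.IsLE b := inferInstanceAs (X.obj.IsLE b)
    have : Epi ((homologyFunctor _ b).map (Triangle.mk φ g h).mor₁) := by assumption
    exact isLE_obj₃_of_epi _ hT b

lemma exists_trW_of_isGE_of_isLE (k : ℕ) (X : (boundedDerived R).FullSubcategory) (a : ℤ)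
    [X.obj.IsGE a] [X.obj.IsLE (a + k)] :
    ∃ (Y : (boundedDerived R).FullSubcategory) (f : X ⟶ Y),
      ((perfect R).inverseImage (boundedDerived R).ι).trW f ∧
        Y.obj.IsGE a ∧ Y.obj.IsLE a := by
  induction k generalizing X with
  | zero =>
    exact ⟨X, 𝟙 X, MorphismProperty.id_mem _ _, inferInstance, by
      rwa [← add_zero a]⟩
  | succ k ih =>
    obtain ⟨Y, f, hf, _, hY⟩ := exists_trW_isLE_sub_one X a (a + (k + 1 : ℕ)) (by lia)
    have : Y.obj.IsLE (a + k) := by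
      rwa [show a + ((k + 1 : ℕ) : ℤ) - 1 = a + k by push_cast; ring] at hY
    obtain ⟨Z, g, hg, h⟩ := ih Y
    exact ⟨Z, f ≫ g, MorphismProperty.comp_mem _ _ _ hf hg, h⟩

/-- Up to perfect complexes, an object of `D^f(R)` is a finitely generated module placed in any
sufficiently small degree. -/
lemma exists_trW_single (X : (boundedDerived R).FullSubcategory) (a : ℤ) [X.obj.IsGE a] :
    ∃ (N : FGModuleCat.{u} R) (f : X.obj ⟶ (singleFunctor (ModuleCat.{u} R) a).obj N.obj),
      (perfect R).trW f := by
  obtain ⟨-, b, -, _⟩ := exists_isGE_isLE X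
  -- If `b < a`, the truncation to `0` just weakens the upper bound to `a`.
  have : X.obj.IsLE (a + (b - a).toNat) := TStructure.t.isLE_of_le _ b _ (by lia)
  obtain ⟨Y, f, hf, _, _⟩ := exists_trW_of_isGE_of_isLE (b - a).toNat X a
  obtain ⟨N, ⟨e⟩⟩ := exists_iso_singleFunctor_obj_of_isGE_of_isLE Y.obj a
  have := ((boundedDerived_iff _).1 Y.property).1 a
  let e' : (homologyFunctor (ModuleCat.{u} R) a).obj Y.obj ≅ N :=
    (homologyFunctor _ a).mapIso e ≪≫ (singleFunctorCompHomologyFunctorIso _ a).app N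
  have hN : Module.Finite R N := Module.Finite.equiv e'.toLinearEquiv
  rw [ObjectProperty.inverseImage_trW_iff] at hf
  exact ⟨⟨N, hN⟩, f.hom ≫ e.hom,
    MorphismProperty.comp_mem _ _ _ hf ((perfect R).trW_of_isIso e.hom)⟩

end CohAnn
-- Comparison of the annihilators
namespace CohAnn

open DerivedCategory Pretriangulated

variable {R : Type u} [CommRing R] [HasDerivedCategory.{w} (ModuleCat.{u} R)]

/-- The cohomological annihilator kills every morphism from `M` to a finitely generated
module placed in a sufficiently small degree. -/
lemma smul_eq_zero_of_mem_caLevel {n i : ℕ} {M : ModuleCat.{u} R} {r : R}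
    (hr : r ∈ caLevel R n M) (hi : n ≤ i) (N : FGModuleCat.{u} R) {a b : ℤ} (hab : b + i = a)
    (f : (singleFunctor (ModuleCat.{u} R) a).obj M ⟶ (singleFunctor _ b).obj N.obj) :
    r • f = 0 := by
  let α := ((singleFunctors (ModuleCat.{u} R)).shiftIso a 0 a (by lia)).app M
  let β := ((singleFunctors (ModuleCat.{u} R)).shiftIso a (-i) b (by lia)).app N.obj
  let γ := ((singleFunctors (ModuleCat.{u} R)).shiftIso i (-i) 0 (by lia)).app N.obj
  let g : (singleFunctor (ModuleCat.{u} R) 0).obj M ⟶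
      ((singleFunctor (ModuleCat.{u} R) 0).obj N.obj)⟦(i : ℤ)⟧ :=
    α.inv ≫ f⟦a⟧' ≫ β.hom ≫ γ.inv
  have hg : r • g = 0 := by
    have := mem_caLevel_iff.1 hr i hi N (Ext.homLinearEquiv (R := R).symm g)
    rwa [← map_smul, LinearEquiv.map_eq_zero_iff] at this
  have hf : f⟦a⟧' = α.hom ≫ g ≫ γ.hom ≫ β.inv := by simp [g]
  apply (shiftFunctor (DerivedCategory (ModuleCat.{u} R)) a).map_injective
  rw [Functor.map_smul, hf, ← Linear.comp_smul, ← Linear.smul_comp, hg]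
  simp

variable [IsNoetherianRing R]

lemma mem_annObj_iff {X : SingularityCategory R} {r : R} : r ∈ annObj X ↔ r • 𝟙 X = 0 := by
  rw [annObj, Module.mem_annihilator]
  refine ⟨fun h => h _, fun h f => ?_⟩
  rw [← Category.id_comp f, ← Linear.smul_comp, h, zero_comp]

/-- The quotient functor `D^f(R) ⥤ D_sg(R)`. -/
noncomputable abbrev quotientFunctor (R : Type u) [CommRing R] [HasDerivedCategory.{w} (ModuleCat.{u} R)]
    [IsNoetherianRing R] : (boundedDerived R).FullSubcategory ⥤ SingularityCategory R :=
  ((perfect R).inverseImage (boundedDerived R).ι).trW.Q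

lemma mem_annObj_of_trW {X Y : (boundedDerived R).FullSubcategory} {f : X.obj ⟶ Y.obj}
    (hf : (perfect R).trW f) {r : R} (h : r • f = 0) :
    r ∈ annObj ((quotientFunctor R).obj X) := by
  rw [mem_annObj_iff, ← CategoryTheory.Functor.map_id, ← Functor.map_smul, ← Functor.map_zero (quotientFunctor R),
    MorphismProperty.map_eq_iff_postcomp (quotientFunctor R)
      ((perfect R).inverseImage (boundedDerived R).ι).trW]
  refine ⟨Y, ObjectProperty.homMk f, ?_, ?_⟩
  · rwa [ObjectProperty.inverseImage_trW_iff]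
  · have : r • ObjectProperty.homMk f = (0 : X ⟶ Y) := ObjectProperty.hom_ext _ h
    simpa using this

lemma exists_trW_of_mem_annObj {X : (boundedDerived R).FullSubcategory} {r : R}
    (h : r ∈ annObj ((quotientFunctor R).obj X)) :
    ∃ (Y : DerivedCategory (ModuleCat.{u} R)) (f : X.obj ⟶ Y), (perfect R).trW f ∧ r • f = 0 := by
  rw [mem_annObj_iff, ← CategoryTheory.Functor.map_id, ← Functor.map_smul, ← Functor.map_zero (quotientFunctor R),
    MorphismProperty.map_eq_iff_postcomp (quotientFunctor R)
      ((perfect R).inverseImage (boundedDerived R).ι).trW] at h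
  obtain ⟨Y, f, hf, h⟩ := h
  rw [ObjectProperty.inverseImage_trW_iff] at hf
  refine ⟨Y.obj, f.hom, hf, ?_⟩
  have h : r • f = 0 := by simpa using h
  exact congr_arg (boundedDerived R).ι.map h

lemma ca_le_annObj (M : FGModuleCat.{u} R) :
    ca R M.obj ≤ annObj ((toSingularityCategory R).obj M) := by
  intro r hr
  obtain ⟨n, hr⟩ := mem_ca_iff.1 hr
  let X : (boundedDerived R).FullSubcategory :=
    ⟨(singleFunctor (ModuleCat.{u} R) 0).obj M.obj, boundedDerived_single R M.obj⟩
  have : X.obj.IsGE (-n) :=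
    TStructure.t.isGE_of_ge ((singleFunctor _ 0).obj M.obj) (-n) 0 (by lia)
  obtain ⟨N, f, hf⟩ := exists_trW_single X (-n)
  exact mem_annObj_of_trW (X := X) (Y := ⟨_, boundedDerived_singleFunctor R N.obj _⟩) hf
    (smul_eq_zero_of_mem_caLevel hr le_rfl N (by lia) f)

lemma annObj_le_ca (M : FGModuleCat.{u} R) :
    annObj ((toSingularityCategory R).obj M) ≤ ca R M.obj := by
  intro r hr
  obtain ⟨Y, s, hs, hrs⟩ := exists_trW_of_mem_annObj
    (X := ⟨(singleFunctor (ModuleCat.{u} R) 0).obj M.obj, boundedDerived_single R M.obj⟩) hr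
  rw [ObjectProperty.trW_iff'] at hs
  obtain ⟨P, g, h, hT, hP⟩ := hs
  obtain ⟨n, hn⟩ := perfect_le_vanishesOnConnective R _ hP
  refine mem_ca_iff.2 ⟨(-n).toNat, mem_caLevel_iff.2 fun i hi N e => ?_⟩
  have : (((singleFunctor (ModuleCat.{u} R) 0).obj N.obj)⟦(i : ℤ)⟧).IsLE n := by
    have := TStructure.t.isLE_shift ((singleFunctor (ModuleCat.{u} R) 0).obj N.obj) 0 i (-i)
    exact TStructure.t.isLE_of_le _ (-i) n (by lia)
  ext
  obtain ⟨e', he'⟩ := Triangle.yoneda_exact₂ _ hT e.hom (hn _ _)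
  rw [Ext.smul_hom, Ext.zero_hom]
  exact (congr_arg (r • ·) he').trans
    ((Linear.smul_comp _ _ _ r s e').symm.trans ((congr_arg (· ≫ e') hrs).trans zero_comp))

lemma ca_eq_annObj (M : FGModuleCat.{u} R) :
    ca R M.obj = annObj ((toSingularityCategory R).obj M) :=
  (ca_le_annObj M).antisymm (annObj_le_ca M)

lemma annSingularityCategory_eq_iInf_ca :
    annSingularityCategory R = ⨅ M : FGModuleCat.{u} R, ca R M.obj := by
  refine le_antisymm (le_iInf fun M => (iInf_le _ _).trans (annObj_le_ca M))
    (le_iInf fun X => ?_)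
  intro r hr
  obtain ⟨X, rfl⟩ := Localization.Construction.objEquiv
    ((perfect R).inverseImage (boundedDerived R).ι).trW |>.surjective X
  obtain ⟨a, -, _, -⟩ := exists_isGE_isLE X
  obtain ⟨N, f, hf⟩ := exists_trW_single X a
  obtain ⟨n, hn⟩ := mem_ca_iff.1 ((Submodule.mem_iInf _).1 hr N)
  let Y : (boundedDerived R).FullSubcategory :=
    ⟨(singleFunctor (ModuleCat.{u} R) a).obj N.obj, boundedDerived_singleFunctor R N.obj a⟩
  have : Y.obj.IsGE (a - n) :=
    TStructure.t.isGE_of_ge ((singleFunctor _ a).obj N.obj) (a - n) a (by lia)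
  obtain ⟨K, g, hg⟩ := exists_trW_single Y (a - n)
  refine mem_annObj_of_trW (X := X) (Y := ⟨_, boundedDerived_singleFunctor R K.obj _⟩)
    (MorphismProperty.comp_mem _ _ _ hf hg) ?_
  rw [← Linear.comp_smul]
  exact (congr_arg (f ≫ ·) (smul_eq_zero_of_mem_caLevel hn le_rfl K (by lia) g)).trans comp_zero

end CohAnn

theorem mainTheorem8 (R : Type u) [CommRing R] [IsNoetherianRing R]
    [HasDerivedCategory.{w} (ModuleCat.{u} R)] :
    (∀ M : FGModuleCat.{u} R,
      CohAnn.ca R M.obj = CohAnn.annObj ((CohAnn.toSingularityCategory R).obj M)) ∧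
    CohAnn.annSingularityCategory R = ⨅ M : FGModuleCat.{u} R, CohAnn.ca R M.obj :=
  ⟨CohAnn.ca_eq_annObj, CohAnn.annSingularityCategory_eq_iInf_ca⟩
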